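/- Let $V$ be a $3$-dimensional complex vector space with a hermitian form $\langle-,-\rangle$ of signature $++-$, and let $\mathbb B\subset\mathbb P_{\mathbb C}V$ be the open ball of negative points, $\mathbb B=\{p\mid\langle p,p\rangle<0\}$. For a $\mathbb C$-linear map $h:V\to V$ of rank $2$ with $h^*=h$ (adjoint with respect to the form) and $\operatorname{tr}h=0$, let the *focus* of $h$ be the point $f$ with $\{f\}=\mathbb P_{\mathbb C}\ker h$, and let $B_h=\{p\in\mathbb P_{\mathbb C}V\mid\langle hp,p\rangle=0\}$; if $B_h\ne\{f\}$, then $B_h$ is called the *bisector* given by $h$, and its *slices* are the projective lines spanned by $f$ and a point of $B_h\setminus\{f\}$. **Corollary 4.8 (Giraud rigidity).** Let $B_{h_1},B_{h_2}$ be bisectors that have no common slice and such that $D:=B_{h_1}\cap B_{h_2}\cap\mathbb B$ is nonempty. Then: 1. $D$ is a smooth surface except possibly at a single point, which is one of the two foci; that is, for the focus $f$ of $B_{h_1}$ or of $B_{h_2}$, the set $D\setminus\{f\}$ is nonempty and is a smooth embedded real $2$-dimensional submanifold of $\mathbb P_{\mathbb C}V$. 2. For every nonempty (relatively) open subset $U$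 of $D$, there is at most one bisector different from $B_{h_1}$ and $B_{h_2}$ that contains $U$. 3. Any bisector that contains such a set $U$ contains the whole intersection $B_{h_1}\cap B_{h_2}$ in $\mathbb P_{\mathbb C}V$. -/

import Mathlib

open scoped LinearAlgebra.Projectivization ContDiff

namespace Giraud

/-- `B` is a hermitian form of signature `++-` on the three-dimensional complex space `V`
(linear in the first argument, conjugate-linear in the second one). -/
def IsHermitianFormPPM {V : Type*} [AddCommGroup V] [Module ℂ V]
    (B : V →ₗ[ℂ] V →ₗ⋆[ℂ] ℂ) : Prop :=
  (∀ x y : V, B x y = star (B y x)) ∧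
    ∃ b : Module.Basis (Fin 3) ℂ V, ∀ i j : Fin 3,
      B (b i) (b j) = if i = j then (![1, 1, -1] : Fin 3 → ℂ) i else 0

/-- The quotient topology on the complex projective space of `V`. -/
noncomputable instance projTopology {V : Type*} [AddCommGroup V] [Module ℂ V] [TopologicalSpace V] :
    TopologicalSpace (ℙ ℂ V) :=
  TopologicalSpace.coinduced (fun v : {v : V // v ≠ 0} => Projectivization.mk' ℂ v) inferInstance

/-- The open ball of negative points of the projective plane. -/
def ball {V : Type*} [AddCommGroup V] [Module ℂ V] (B : V →ₗ[ℂ] V →ₗ⋆[ℂ] ℂ) :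
    Set (ℙ ℂ V) :=
  {p | (B p.rep p.rep).re < 0}

/-- The locus `⟨h p, p⟩ = 0` in the projective plane. -/
def locus {V : Type*} [AddCommGroup V] [Module ℂ V] (B : V →ₗ[ℂ] V →ₗ⋆[ℂ] ℂ)
    (h : V →ₗ[ℂ] V) : Set (ℙ ℂ V) :=
  {p | B (h p.rep) p.rep = 0}

/-- The projectivization of `ker h`. When `V` has dimension three and `h` has rank two, this set
is a single point, the focus. -/
def focusSet {V : Type*} [AddCommGroup V] [Module ℂ V] (h : V →ₗ[ℂ] V) : Set (ℙ ℂ V) :=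
  {p | h p.rep = 0}

/-- The condition on `h` under which `locus B h` is the bisector given by `h`: `h` is traceless,
selfadjoint, of rank two, and its locus is not reduced to the focus. -/
def GivesBisector {V : Type*} [AddCommGroup V] [Module ℂ V] (B : V →ₗ[ℂ] V →ₗ⋆[ℂ] ℂ)
    (h : V →ₗ[ℂ] V) : Prop :=
  Module.finrank ℂ (LinearMap.range h) = 2 ∧
    (∀ x y : V, B (h x) y = B x (h y)) ∧
    LinearMap.trace ℂ V h = 0 ∧
    locus B h ≠ focusSet h

/-- A subset of the projective plane is a bisector if it is the bisector given by some `h`. -/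
def IsBisector {V : Type*} [AddCommGroup V] [Module ℂ V] (B : V →ₗ[ℂ] V →ₗ⋆[ℂ] ℂ)
    (X : Set (ℙ ℂ V)) : Prop :=
  ∃ h : V →ₗ[ℂ] V, GivesBisector B h ∧ X = locus B h

/-- The projective line spanned by `p` and `q` (for `p ≠ q`). -/
def projLine {V : Type*} [AddCommGroup V] [Module ℂ V] (p q : ℙ ℂ V) : Set (ℙ ℂ V) :=
  {x | x.submodule ≤ p.submodule ⊔ q.submodule}

/-- The slices of the bisector given by `h` are the projective lines spanned by the focus and
another point of the bisector. -/
def IsSlice {V : Type*} [AddCommGroup V] [Module ℂ V] (B : V →ₗ[ℂ] V →ₗ⋆[ℂ] ℂ)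
    (h : V →ₗ[ℂ] V) (S : Set (ℙ ℂ V)) : Prop :=
  ∃ f ∈ focusSet h, ∃ p ∈ locus B h \ focusSet h, S = projLine f p

theorem affine_ne_zero {V : Type*} [AddCommGroup V] [Module ℂ V]
    (b : Module.Basis (Fin 3) ℂ V) (z : ℂ × ℂ) : z.1 • b 0 + z.2 • b 1 + b 2 ≠ 0 := by
  intro h
  have := congrArg (fun v => b.repr v 2) h
  simp at this

/-- The (inverse of the) affine chart `(z₁, z₂) ↦ [z₁ : z₂ : 1]` of the projective plane in the
homogeneous coordinates given by the basis `b`. -/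
noncomputable def affineChart {V : Type*} [AddCommGroup V] [Module ℂ V]
    (b : Module.Basis (Fin 3) ℂ V) (z : ℂ × ℂ) : ℙ ℂ V :=
  Projectivization.mk ℂ (z.1 • b 0 + z.2 • b 1 + b 2) (affine_ne_zero b z)

/-- `S` is a smooth (embedded, two-dimensional real) surface in the projective plane, a smooth
four-dimensional real manifold: near each of its points, in some affine chart, `S` is the zero set
of a smooth submersion to a real plane. -/
def IsSmoothSurface {V : Type*} [AddCommGroup V] [Module ℂ V] (S : Set (ℙ ℂ V)) : Prop :=
  ∀ p ∈ S, ∃ b : Module.Basis (Fin 3) ℂ V, ∃ N : Set (ℂ × ℂ), ∃ F : ℂ × ℂ → ℝ × ℝ,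
    IsOpen N ∧ p ∈ affineChart b '' N ∧ ContDiffOn ℝ ∞ F N ∧
    (∀ z ∈ N, Function.Surjective (fderiv ℝ F z)) ∧
    ∀ z ∈ N, (affineChart b z ∈ S ↔ F z = 0)

end Giraud

/-! The two foci are distinct. If they coincided at `f`, any common point of the bisectors other
than `f` would span a common slice with `f`. So `f` would be the given negative point, both forms
would restrict to traceless hermitian forms on the positive definite plane orthogonal to `f`, and
two such forms have a common isotropic vector, which again spans a common slice
(`apply_focus_ne_zero`).

With the foci as `e 0` and `e 1`, the form of each `hᵢ` omits the coordinate of its own focus. In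
the chart with third coordinate `1` the intersection is therefore a product of two generalized
circles, one in each complex coordinate. They are nondegenerate because the forms are indefinite
modulo their kernels (`discriminant_neg`), and not both straight, since otherwise the line through
the foci would be a common slice. A product of circles is a smooth surface. At infinity the
intersection contains at most one point, a focus, and that point is a limit of points in the chart.

A hermitian form vanishing on a product of two arcs is a real combination `s * h₂ + t * h₁` of the
two equations (`product_arcs_rigidity`), so it vanishes on the whole intersection. Its determinant
is a nonzero constant times `s * t` times a nonzero linear form in `(s, t)`. Besides the two given
bisectors, the pencil thus has at most one degenerate member. -/

namespace Giraud

open Complex Filter Topology ComplexConjugate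

/-! ### Generalized circles and arcs on them -/

/-- The real function `a|z|² + 2 Re (k z) + c`, whose zero set is a generalized circle. -/
noncomputable def circleFn (a : ℝ) (k : ℂ) (c : ℝ) (z : ℂ) : ℝ :=
  a * normSq z + 2 * (k * z).re + c

theorem circleFn_add (a : ℝ) (k : ℂ) (c : ℝ) (z v : ℂ) :
    circleFn a k c (z + v) = circleFn a k c z + a * normSq v + 2 * ((a * conj z + k) * v).re := by
  simp [circleFn, normSq_apply]; ring

theorem mul_circleFn (a : ℝ) (k : ℂ) (c : ℝ) (z : ℂ) :
    a * circleFn a k c z = normSq (a * conj z + k) + a * c - normSq k := by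
  simp [circleFn, normSq_apply]; ring

/-- By completing the square (`mul_circleFn`), `a * conj z + k` has squared modulus `normSq k - a *
c` at every zero. This covers lines, `a = 0`, as well as circles. -/
theorem circleFn_gradient_ne_zero {a : ℝ} {k : ℂ} {c : ℝ} (hdisc : a * c < normSq k) {z : ℂ}
    (hz : circleFn a k c z = 0) : a * conj z + k ≠ 0 := by
  intro h
  have := mul_circleFn a k c z
  rw [h, hz] at this
  simp at this
  linarith

theorem exists_circleFn_eq_zero {a : ℝ} {k : ℂ} {c : ℝ} (hdisc : a * c < normSq k) (ha : a ≠ 0) :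
    ∃ z, circleFn a k c z = 0 := by
  -- The centre `-conj k / a` displaced by the signed radius.
  refine ⟨(-conj k + (Real.sqrt (normSq k - a * c) : ℂ)) / a, ?_⟩
  have ha' : (a : ℂ) ≠ 0 := by exact_mod_cast ha
  have h := mul_circleFn a k c ((-conj k + (Real.sqrt (normSq k - a * c) : ℂ)) / a)
  have h2 : (a : ℂ) * conj ((-conj k + (Real.sqrt (normSq k - a * c) : ℂ)) / a) + k
      = (Real.sqrt (normSq k - a * c) : ℂ) := by
    simp only [map_div₀, map_add, map_neg, conj_conj, conj_ofReal]
    field_simp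
    ring
  rw [h2, normSq_ofReal, Real.mul_self_sqrt (by linarith)] at h
  have : a * circleFn a k c ((-conj k + (Real.sqrt (normSq k - a * c) : ℂ)) / a) = 0 := by
    rw [h]; ring
  exact (mul_eq_zero.1 this).resolve_left ha

/-- These points run to infinity along the line as `t → 0`. In homogeneous coordinates the numerator
tends to `I / l` and the denominator to `0`, so the point at infinity is a limit of points of the
line. -/
theorem circleFn_zero_line {l : ℂ} (hl : l ≠ 0) (c : ℝ) {t : ℝ} (ht : t ≠ 0) :
    circleFn 0 l c ((I / l + t * (-(c / 2) / l)) / t) = 0 := by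
  have ht' : (t : ℂ) ≠ 0 := by exact_mod_cast ht
  have : l * ((I / l + t * (-(c / 2) / l)) / t) = I * (t⁻¹ : ℝ) - (c / 2 : ℝ) := by
    push_cast
    field_simp
    ring
  rw [circleFn, this, sub_re, ofReal_re, re_mul_ofReal]
  simp
  ring

/-- A curve through `0` along which a circle function with value `0` and gradient `w` at a point
stays zero. -/
noncomputable def arc (a : ℝ) (w : ℂ) (t : ℝ) : ℂ :=
  conj w * t / (-I - (a * t / 2 : ℝ))

theorem arc_denom_ne_zero (s : ℝ) : -I - (s : ℂ) ≠ 0 := by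
  intro h
  have := congrArg Complex.im h
  simp at this

/-- Inversion straightens the circle: `a * normSq v + 2 * (w * v).re = 0` with `v ≠ 0` says that
`conj w / v` has real part `-a / 2`, and `arc` takes its imaginary part to be `-1 / t`. Along this
curve the second function, up to a positive denominator, is `t` times an affine function of `t`. -/
theorem arc_eq (p a : ℝ) (u w : ℂ) (t : ℝ) :
    (p * normSq (arc a w t) + 2 * (u * arc a w t).re) * (1 + (a * t / 2) ^ 2) =
      t * (p * t * normSq w - a * t * (u * conj w).re - 2 * (u * conj w).im) := by
  have hs : (1 + (a * t / 2) ^ 2 : ℝ) ≠ 0 := by positivity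
  have h1 : arc a w t = conj w * t * (I - (a * t / 2 : ℝ)) / ((1 + (a * t / 2) ^ 2 : ℝ) : ℂ) := by
    have hs' : ((1 + (a * t / 2) ^ 2 : ℝ) : ℂ) ≠ 0 := by exact_mod_cast hs
    rw [arc, div_eq_div_iff (arc_denom_ne_zero _) hs']
    have : ((1 + (a * t / 2) ^ 2 : ℝ) : ℂ)
        = (I - (a * t / 2 : ℝ)) * (-I - (a * t / 2 : ℝ)) := by
      push_cast
      linear_combination Complex.I_sq
    rw [this]; ring
  have h2 : normSq (arc a w t) = normSq w * t ^ 2 / (1 + (a * t / 2) ^ 2) := by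
    rw [h1]
    simp only [map_div₀, map_mul, normSq_conj, normSq_ofReal]
    have : normSq (I - ((a * t / 2 : ℝ) : ℂ)) = 1 + (a * t / 2) ^ 2 := by
      rw [normSq_apply]
      simp only [sub_re, sub_im, I_re, I_im, ofReal_re, ofReal_im]
      ring
    rw [this]
    field_simp
  have h3 : (u * arc a w t).re =
      t * (-(a * t / 2) * (u * conj w).re - (u * conj w).im) / (1 + (a * t / 2) ^ 2) := by
    rw [h1, ← mul_div_assoc, div_ofReal_re]
    congr 1
    simp
    ring
  rw [h2, h3]
  field_simp
  ring

theorem circleFn_arc {a : ℝ} {k : ℂ} {c : ℝ} {z : ℂ} (hz : circleFn a k c z = 0) (t : ℝ) :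
    circleFn a k c (z + arc a (a * conj z + k) t) = 0 := by
  have h := arc_eq a a (a * conj z + k) (a * conj z + k) t
  rw [circleFn_add, hz]
  set w := a * conj z + k
  have hw : w * conj w = (normSq w : ℂ) := mul_conj w
  rw [hw, ofReal_re, ofReal_im] at h
  have hs : (1 + (a * t / 2) ^ 2 : ℝ) ≠ 0 := by positivity
  have : (a * normSq (arc a w t) + 2 * (w * arc a w t).re) * (1 + (a * t / 2) ^ 2) = 0 := by
    rw [h]; ring
  rcases mul_eq_zero.1 this with h | h
  · linarith
  · exact absurd h hs

theorem continuous_arc (a : ℝ) (w : ℂ) : Continuous (arc a w) := by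
  unfold arc
  exact Continuous.div (by fun_prop) (by fun_prop) (fun t => arc_denom_ne_zero _)

/-- A circle function vanishing on an arc of a circle is proportional to the function defining
the circle. -/
theorem circleFn_proportional {a : ℝ} {k : ℂ} {c : ℝ} (hdisc : a * c < normSq k) {z : ℂ}
    (hz : circleFn a k c z = 0) {N : Set ℂ} (hN : N ∈ 𝓝 z) {p : ℝ} {q : ℂ} {r : ℝ}
    (hv : ∀ x ∈ N, circleFn a k c x = 0 → circleFn p q r x = 0) :
    ∃ s : ℝ, p = s * a ∧ q = s * k ∧ r = s * c := by
  have hw := circleFn_gradient_ne_zero hdisc hz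
  set w := a * conj z + k with hwdef
  set u := p * conj z + q with hudef
  have h0 : circleFn p q r z = 0 := hv z (mem_of_mem_nhds hN) hz
  have hcont : Tendsto (fun t : ℝ => z + arc a w t) (𝓝 0) (𝓝 z) := by
    have h : Continuous fun t : ℝ => z + arc a w t := continuous_const.add (continuous_arc a w)
    have h' := h.tendsto 0
    have h0 : z + arc a w 0 = z := by simp [arc]
    rwa [h0] at h'
  have hev := hcont.eventually hN
  obtain ⟨ε, hε, hball⟩ := Metric.eventually_nhds_iff.1 hev
  have key : ∀ t : ℝ, |t| < ε → t ≠ 0 →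
      p * t * normSq w - a * t * (u * conj w).re - 2 * (u * conj w).im = 0 := by
    intro t ht ht0
    have h1 := hv _ (hball (by simpa using ht)) (circleFn_arc hz t)
    rw [circleFn_add, h0, zero_add] at h1
    have h2 := arc_eq p a u w t
    rw [h1, zero_mul] at h2
    exact (mul_eq_zero.1 h2.symm).resolve_left ht0
  -- An expression affine in `t` that vanishes at two opposite parameters has both coefficients
  -- zero. The constant one makes the gradients real-proportional, and the other fixes `p`.
  have k1 := key (ε / 2) (by rw [abs_of_pos (by linarith)]; linarith) (by positivity)
  have k2 := key (-(ε / 2)) (by rw [abs_neg, abs_of_pos (by linarith)]; linarith)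
    (by simp; positivity)
  have him : (u * conj w).im = 0 := by linarith
  have hre : p * normSq w = a * (u * conj w).re := by
    have : ε * (p * normSq w - a * (u * conj w).re) = 0 := by linarith
    have := (mul_eq_zero.1 this).resolve_left hε.ne'
    linarith
  have hnw : normSq w ≠ 0 := by simpa using hw
  have hnw' : (normSq w : ℂ) ≠ 0 := by exact_mod_cast hnw
  have huw : u * conj w = ((u * conj w).re : ℂ) := by
    apply Complex.ext
    · simp
    · rw [him, ofReal_im]
  set ρ := (u * conj w).re
  have hu : u = ((ρ / normSq w : ℝ) : ℂ) * w := by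
    have : u * normSq w = ρ * w := by rw [← huw, ← mul_conj]; ring
    push_cast
    field_simp
    exact this
  have hp : p = ρ / normSq w * a := by field_simp; linarith
  have hq : q = (ρ / normSq w : ℝ) * k := by
    have : q = u - p * conj z := by rw [hudef]; ring
    rw [this, hu, hp, hwdef]; push_cast; ring
  refine ⟨ρ / normSq w, hp, hq, ?_⟩
  set s := ρ / normSq w
  unfold circleFn at h0 hz
  rw [hp, hq, mul_assoc (s : ℂ), re_ofReal_mul] at h0
  linear_combination h0 - s * hz

/-! ### Rigidity on a product of two arcs -/

/-- The case of `product_arcs_rigidity` in which the first arc is not straight. -/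
theorem product_arcs_rigidity_aux {a : ℝ} {l : ℂ} {c : ℝ} (h₁ : a * c < normSq l)
    {d : ℝ} {k : ℂ} {g : ℝ} (h₂ : d * g < normSq k) (hd : d ≠ 0)
    {z w : ℂ} (hz : circleFn d k g z = 0) (hw : circleFn a l c w = 0)
    {M N : Set ℂ} (hM : M ∈ 𝓝 z) (hN : N ∈ 𝓝 w) {n₀ n₁ n₂ : ℝ} {m m₀ m₁ : ℂ}
    (hv : ∀ x ∈ M, ∀ y ∈ N, circleFn d k g x = 0 → circleFn a l c y = 0 →
      n₀ * normSq x + n₁ * normSq y + n₂ + 2 * (m * x * conj y).re + 2 * (m₀ * x).re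
        + 2 * (m₁ * y).re = 0) :
    ∃ s t : ℝ, n₀ = s * d ∧ m₀ = s * k ∧ n₁ = t * a ∧ m₁ = t * l ∧ n₂ = s * g + t * c ∧
      m = 0 := by
  -- For fixed `y` the polynomial is a circle function of `x`, hence a multiple of the first
  -- equation. As `d ≠ 0`, comparing the coefficients of `normSq x` gives the factor `n₀ / d`,
  -- independent of `y`.
  have step : ∀ y ∈ N, circleFn a l c y = 0 → m * conj y + m₀ = (n₀ / d : ℝ) * k ∧
      circleFn n₁ m₁ n₂ y = (n₀ / d) * g := by
    intro y hy hy0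
    obtain ⟨s, hs1, hs2, hs3⟩ := circleFn_proportional h₂ hz hM (p := n₀) (q := m * conj y + m₀)
      (r := circleFn n₁ m₁ n₂ y) (fun x hx hx0 => by
        rw [← hv x hx y hy hx0 hy0]
        simp [circleFn]; ring)
    have : s = n₀ / d := by rw [hs1]; field_simp
    rw [← this]
    exact ⟨hs2, hs3⟩
  have hm : m = 0 := by
    -- By `step`, `m * conj y` is constant on the second arc. Multiplying the conjugate equation by
    -- `η` and taking real parts yields a real affine equation on that arc, so `η * conj m` is a
    -- real multiple of `l`. This cannot hold for both `η = 1` and `η = I` unless `m = 0`.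
    have h : ∀ η : ℂ, ∃ s : ℝ, η * conj m = s * l := by
      intro η
      obtain ⟨s, -, hs, -⟩ := circleFn_proportional h₁ hw hN (p := 0) (q := η * conj m)
        (r := 2 * (η * conj (m₀ - (n₀ / d : ℝ) * k)).re) (fun y hy hy0 => by
          have h1 := (step y hy hy0).1
          have h2 : conj m * y + conj (m₀ - (n₀ / d : ℝ) * k) = 0 := by
            rw [← h1]; simp
          have h3 : 2 * (η * (conj m * y + conj (m₀ - (n₀ / d : ℝ) * k))).re = 0 := by
            rw [h2]; simp
          rw [mul_add, add_re, ← mul_assoc] at h3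
          unfold circleFn
          linarith)
      exact ⟨s, hs⟩
    obtain ⟨s, hs⟩ := h 1
    obtain ⟨t, ht⟩ := h I
    by_contra hm
    have hm' : conj m ≠ 0 := by simpa using hm
    have hl : l ≠ 0 := by
      rintro rfl
      simp at hs
      exact hm hs
    have h1 : (I * s - t) * l = 0 := by linear_combination ht - I * hs
    have h2 := (mul_eq_zero.1 h1).resolve_right hl
    have h3 : s = 0 := by simpa using congrArg Complex.im h2
    rw [h3] at hs
    simp at hs
    exact hm hs
  have h0 := step w (mem_of_mem_nhds hN) hw
  obtain ⟨t, ht1, ht2, ht3⟩ := circleFn_proportional h₁ hw hN (p := n₁) (q := m₁)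
    (r := n₂ - (n₀ / d) * g) (fun y hy hy0 => by
      have := (step y hy hy0).2
      unfold circleFn at this ⊢
      linarith)
  refine ⟨n₀ / d, t, by field_simp, ?_, ht1, ht2, by linarith, hm⟩
  rw [← h0.1, hm]; simp

/-- A hermitian polynomial of degree one in each of two variables and their conjugates that
vanishes on a product of two arcs, not both of them straight, is a combination of the equations
of the arcs. -/
theorem product_arcs_rigidity {a : ℝ} {l : ℂ} {c : ℝ} (h₁ : a * c < normSq l)
    {d : ℝ} {k : ℂ} {g : ℝ} (h₂ : d * g < normSq k) (had : ¬ (a = 0 ∧ d = 0))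
    {z w : ℂ} (hz : circleFn d k g z = 0) (hw : circleFn a l c w = 0)
    {M N : Set ℂ} (hM : M ∈ 𝓝 z) (hN : N ∈ 𝓝 w) {n₀ n₁ n₂ : ℝ} {m m₀ m₁ : ℂ}
    (hv : ∀ x ∈ M, ∀ y ∈ N, circleFn d k g x = 0 → circleFn a l c y = 0 →
      n₀ * normSq x + n₁ * normSq y + n₂ + 2 * (m * x * conj y).re + 2 * (m₀ * x).re
        + 2 * (m₁ * y).re = 0) :
    ∃ s t : ℝ, n₀ = s * d ∧ m₀ = s * k ∧ n₁ = t * a ∧ m₁ = t * l ∧ n₂ = s * g + t * c ∧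
      m = 0 := by
  by_cases hd : d = 0
  · have ha : a ≠ 0 := fun h => had ⟨h, hd⟩
    obtain ⟨s, t, e1, e2, e3, e4, e5, e6⟩ := product_arcs_rigidity_aux h₂ h₁ ha hw hz hN hM
      (n₀ := n₁) (n₁ := n₀) (n₂ := n₂) (m := conj m) (m₀ := m₁) (m₁ := m₀)
      (fun y hy x hx hy0 hx0 => by
        rw [← hv x hx y hy hx0 hy0]
        have : (conj m * y * conj x).re = (m * x * conj y).re := by
          simp; ring
        rw [this]; ring)
    exact ⟨t, s, e3, e4, e1, e2, by linarith, by simpa using e6⟩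
  · exact product_arcs_rigidity_aux h₁ h₂ hd hz hw hM hN hv

/-! ### Smoothness of products of circles -/

theorem hasFDerivAt_circleFn (a : ℝ) (k : ℂ) (c : ℝ) (z : ℂ) :
    HasFDerivAt (circleFn a k c)
      (((2 : ℝ) • reCLM).comp
        (((a * conj z + k) • (1 : ℂ →L[ℂ] ℂ)).restrictScalars ℝ)) z := by
  have h1 : HasFDerivAt (fun x : ℂ => x.re) reCLM z := reCLM.hasFDerivAt
  have h2 : HasFDerivAt (fun x : ℂ => x.im) imCLM z := imCLM.hasFDerivAt
  have h3 := ((((h1.mul h1).add (h2.mul h2)).const_mul a).add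
    (((h1.const_mul k.re).sub (h2.const_mul k.im)).const_mul 2)).add_const c
  refine (h3.congr_fderiv ?_).congr_of_eventuallyEq ?_
  · ext
    simp; ring
  · exact Eventually.of_forall fun x => by simp [circleFn, normSq_apply]

theorem contDiff_circleFn (a : ℝ) (k : ℂ) (c : ℝ) : ContDiff ℝ ∞ (circleFn a k c) := by
  have h1 : ContDiff ℝ ∞ (fun x : ℂ => x.re) := reCLM.contDiff
  have h2 : ContDiff ℝ ∞ (fun x : ℂ => x.im) := imCLM.contDiff
  have : circleFn a k c = fun x => a * (x.re * x.re + x.im * x.im)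
      + 2 * (k.re * x.re - k.im * x.im) + c := by
    ext x; simp [circleFn, normSq_apply]
  rw [this]
  fun_prop

theorem surjective_fderiv_prod_circleFn {a : ℝ} {l : ℂ} {c : ℝ} {d : ℝ} {k : ℂ} {g : ℝ}
    {z : ℂ × ℂ} (h₁ : d * conj z.1 + k ≠ 0) (h₂ : a * conj z.2 + l ≠ 0) :
    Function.Surjective
      (fderiv ℝ (fun z : ℂ × ℂ => (circleFn d k g z.1, circleFn a l c z.2)) z) := by
  have h := ((hasFDerivAt_circleFn d k g z.1).comp z (hasFDerivAt_fst (𝕜 := ℝ))).prodMk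
    ((hasFDerivAt_circleFn a l c z.2).comp z (hasFDerivAt_snd (𝕜 := ℝ)))
  have h' : fderiv ℝ (fun z : ℂ × ℂ => (circleFn d k g z.1, circleFn a l c z.2)) z = _ :=
    h.fderiv
  rw [h']
  rintro ⟨x, y⟩
  refine ⟨((x / 2 : ℝ) / (d * conj z.1 + k), (y / 2 : ℝ) / (a * conj z.2 + l)), ?_⟩
  apply Prod.ext
  · simp only [ContinuousLinearMap.prod_apply, ContinuousLinearMap.comp_apply,
      ContinuousLinearMap.coe_fst', ContinuousLinearMap.coe_restrictScalars',
      smul_apply, one_apply_eq_self, smul_eq_mul,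
      mul_div_cancel₀ _ h₁, reCLM_apply, ofReal_re]
    ring
  · simp only [ContinuousLinearMap.prod_apply, ContinuousLinearMap.comp_apply,
      ContinuousLinearMap.coe_snd', ContinuousLinearMap.coe_restrictScalars',
      smul_apply, one_apply_eq_self, smul_eq_mul,
      mul_div_cancel₀ _ h₂, reCLM_apply, ofReal_re]
    ring

/-! ### Hermitian forms and bisectors in coordinates -/

section Algebra

variable {V : Type*} [AddCommGroup V] [Module ℂ V] {B : V →ₗ[ℂ] V →ₗ⋆[ℂ] ℂ}

theorem mk_mem_locus {h : V →ₗ[ℂ] V} {v : V} (hv : v ≠ 0) :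
    Projectivization.mk ℂ v hv ∈ locus B h ↔ B (h v) v = 0 := by
  obtain ⟨a, ha⟩ := Projectivization.exists_smul_eq_mk_rep ℂ v hv
  have ha0 : (a : ℂ) ≠ 0 := a.ne_zero
  change B (h (Projectivization.mk ℂ v hv).rep) (Projectivization.mk ℂ v hv).rep = 0 ↔ _
  rw [← ha, Units.smul_def]
  simp [ha0]

theorem mk_mem_focusSet {h : V →ₗ[ℂ] V} {v : V} (hv : v ≠ 0) :
    Projectivization.mk ℂ v hv ∈ focusSet h ↔ h v = 0 := by
  obtain ⟨a, ha⟩ := Projectivization.exists_smul_eq_mk_rep ℂ v hv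
  have ha0 : (a : ℂ) ≠ 0 := a.ne_zero
  change h (Projectivization.mk ℂ v hv).rep = 0 ↔ _
  rw [← ha, Units.smul_def]
  simp [ha0]

theorem mk_mem_ball {v : V} (hv : v ≠ 0) :
    Projectivization.mk ℂ v hv ∈ ball B ↔ (B v v).re < 0 := by
  obtain ⟨a, ha⟩ := Projectivization.exists_smul_eq_mk_rep ℂ v hv
  have ha0 : (a : ℂ) ≠ 0 := a.ne_zero
  change (B (Projectivization.mk ℂ v hv).rep (Projectivization.mk ℂ v hv).rep).re < 0 ↔ _
  rw [← ha, Units.smul_def]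
  have : B ((a : ℂ) • v) ((a : ℂ) • v) = ((normSq a : ℝ) : ℂ) * B v v := by
    rw [← mul_conj]; simp; ring
  rw [this, re_ofReal_mul]
  have hpos : 0 < normSq a := normSq_pos.2 ha0
  constructor
  · intro h; by_contra h'; nlinarith
  · intro h; exact mul_neg_of_pos_of_neg hpos h

theorem exists_generator_ker {h : V →ₗ[ℂ] V} (hV : Module.finrank ℂ V = 3)
    (hr : Module.finrank ℂ (LinearMap.range h) = 2) :
    ∃ f : V, f ≠ 0 ∧ h f = 0 ∧ ∀ x, h x = 0 → ∃ c : ℂ, c • f = x := by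
  have : FiniteDimensional ℂ V := Module.finite_of_finrank_pos (by omega)
  have h1 := LinearMap.finrank_range_add_finrank_ker h
  have h2 : Module.finrank ℂ (LinearMap.ker h) = 1 := by omega
  obtain ⟨v, hv, hv'⟩ := finrank_eq_one_iff'.1 h2
  refine ⟨v, by simpa using hv, v.2, fun x hx => ?_⟩
  obtain ⟨c, hc⟩ := hv' ⟨x, hx⟩
  exact ⟨c, congrArg Subtype.val hc⟩

theorem finrank_eq_three (hB : IsHermitianFormPPM B) : Module.finrank ℂ V = 3 := by
  obtain ⟨-, b, -⟩ := hB
  simp [Module.finrank_eq_card_basis b]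

theorem basis_decomp (b : Module.Basis (Fin 3) ℂ V) (x : V) :
    x = b.repr x 0 • b 0 + b.repr x 1 • b 1 + b.repr x 2 • b 2 := by
  have := b.sum_repr x
  rw [Fin.sum_univ_three] at this
  exact this.symm

theorem form_diagonal {b : Module.Basis (Fin 3) ℂ V}
    (hb : ∀ i j : Fin 3, B (b i) (b j) = if i = j then (![1, 1, -1] : Fin 3 → ℂ) i else 0)
    (x₀ x₁ x₂ y₀ y₁ y₂ : ℂ) :
    B (x₀ • b 0 + x₁ • b 1 + x₂ • b 2) (y₀ • b 0 + y₁ • b 1 + y₂ • b 2) =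
      x₀ * conj y₀ + x₁ * conj y₁ - x₂ * conj y₂ := by
  simp [hb]
  ring

theorem eq_zero_of_form_eq_zero (hB : IsHermitianFormPPM B) {x : V} (hx : ∀ y, B x y = 0) :
    x = 0 := by
  obtain ⟨-, b, hb⟩ := hB
  rw [basis_decomp b x] at hx ⊢
  have h0 := hx ((1 : ℂ) • b 0 + (0 : ℂ) • b 1 + (0 : ℂ) • b 2)
  have h1 := hx ((0 : ℂ) • b 0 + (1 : ℂ) • b 1 + (0 : ℂ) • b 2)
  have h2 := hx ((0 : ℂ) • b 0 + (0 : ℂ) • b 1 + (1 : ℂ) • b 2)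
  rw [form_diagonal hb] at h0 h1 h2
  simp at h0 h1 h2
  simp [h0, h1, h2]

theorem form_apply_conj (hs : ∀ x y : V, B x y = star (B y x)) {h : V →ₗ[ℂ] V}
    (hh : ∀ x y : V, B (h x) y = B x (h y)) (x y : V) : B (h x) y = conj (B (h y) x) := by
  rw [hh, hs]; rfl

theorem form_apply_self (hs : ∀ x y : V, B x y = star (B y x)) {h : V →ₗ[ℂ] V}
    (hh : ∀ x y : V, B (h x) y = B x (h y)) (x : V) : B (h x) x = ((B (h x) x).re : ℂ) :=
  (conj_eq_iff_re.1 (form_apply_conj hs hh x x).symm).symm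

theorem form_expand (hs : ∀ x y : V, B x y = star (B y x)) {h : V →ₗ[ℂ] V}
    (hh : ∀ x y : V, B (h x) y = B x (h y)) (u v w : V) (x y z : ℂ) :
    B (h (x • u + y • v + z • w)) (x • u + y • v + z • w) =
      (((B (h u) u).re * normSq x + (B (h v) v).re * normSq y + (B (h w) w).re * normSq z
        + 2 * (B (h u) v * x * conj y).re + 2 * (B (h u) w * x * conj z).re
        + 2 * (B (h v) w * y * conj z).re : ℝ) : ℂ) := by
  have e : ∀ t : ℂ, ((2 * t.re : ℝ) : ℂ) = t + conj t := fun t => by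
    rw [add_conj]
  simp only [ofReal_add]
  rw [e, e, e]
  simp only [ofReal_mul, ← mul_conj, ← form_apply_self hs hh]
  simp only [map_add, map_smul, map_smulₛₗ, LinearMap.add_apply, LinearMap.smul_apply,
    smul_eq_mul, map_mul, conj_conj]
  rw [form_apply_conj hs hh v u, form_apply_conj hs hh w u, form_apply_conj hs hh w v]
  ring

/-- The focus always lies in the locus, so the locus can differ from it only by a point off the
kernel. -/
theorem exists_isotropic {h : V →ₗ[ℂ] V} (hg : GivesBisector B h) :
    ∃ x : V, B (h x) x = 0 ∧ h x ≠ 0 := by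
  by_contra! hcon
  apply hg.2.2.2
  ext p
  constructor
  · intro hp
    exact hcon _ hp
  · intro hp
    have hp' : h p.rep = 0 := hp
    change B (h p.rep) p.rep = 0
    simp [hp']

/-- The hermitian form given by a bisector is indefinite modulo its kernel. -/
theorem discriminant_neg (hB : IsHermitianFormPPM B) {h : V →ₗ[ℂ] V} (hg : GivesBisector B h)
    {f u v : V} (hf : h f = 0) (hsp : ∀ x : V, ∃ x₀ x₁ x₂ : ℂ, x = x₀ • f + x₁ • u + x₂ • v) :
    (B (h u) u).re * (B (h v) v).re < normSq (B (h u) v) := by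
  have hs := hB.1
  have hh := hg.2.1
  obtain ⟨x, hx, hx0⟩ := exists_isotropic hg
  obtain ⟨x₀, x₁, x₂, rfl⟩ := hsp x
  have hH := form_expand hs hh f u v x₀ x₁ x₂
  rw [hx, hf] at hH
  simp only [map_zero, LinearMap.zero_apply, zero_re, zero_mul, mul_zero, zero_add,
    add_zero] at hH
  set a := (B (h u) u).re
  set c := (B (h v) v).re
  set k := B (h u) v
  have hH' : a * normSq x₁ + c * normSq x₂ + 2 * (k * x₁ * conj x₂).re = 0 := by
    exact_mod_cast hH.symm
  have hy : h (x₀ • f + x₁ • u + x₂ • v) = x₁ • h u + x₂ • h v := by simp [hf]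
  rw [hy] at hx0
  have hP : B (x₁ • h u + x₂ • h v) u = a * x₁ + conj k * x₂ := by
    simp only [map_add, map_smul, LinearMap.add_apply, LinearMap.smul_apply, smul_eq_mul]
    rw [form_apply_conj hs hh v u, form_apply_self hs hh u]; ring
  have hR : B (x₁ • h u + x₂ • h v) v = k * x₁ + c * x₂ := by
    simp only [map_add, map_smul, LinearMap.add_apply, LinearMap.smul_apply, smul_eq_mul]
    rw [form_apply_self hs hh v]; ring
  have hF : B (x₁ • h u + x₂ • h v) f = 0 := by
    simp only [map_add, map_smul, LinearMap.add_apply, LinearMap.smul_apply, smul_eq_mul]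
    rw [form_apply_conj hs hh u f, form_apply_conj hs hh v f, hf]; simp
  have hne : ¬ ((a : ℂ) * x₁ + conj k * x₂ = 0 ∧ k * x₁ + c * x₂ = 0) := by
    rintro ⟨h1, h2⟩
    apply hx0
    apply eq_zero_of_form_eq_zero hB
    intro y
    obtain ⟨y₀, y₁, y₂, rfl⟩ := hsp y
    rw [map_add, map_add, map_smulₛₗ, map_smulₛₗ, map_smulₛₗ, hP, hR, hF, h1, h2]
    simp
  have hpos : 0 < normSq ((a : ℂ) * x₁ + conj k * x₂) + normSq (k * x₁ + c * x₂) := by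
    by_cases h1 : (a : ℂ) * x₁ + conj k * x₂ = 0
    · have h2 : k * x₁ + c * x₂ ≠ 0 := fun h2 => hne ⟨h1, h2⟩
      exact add_pos_of_nonneg_of_pos (normSq_nonneg _) (normSq_pos.2 h2)
    · exact add_pos_of_pos_of_nonneg (normSq_pos.2 h1) (normSq_nonneg _)
  -- Cayley–Hamilton for the 2×2 hermitian matrix `A` of the form: the squared norm of `A x` is the
  -- trace times the value of the form at `x`, minus the determinant times the squared norm of `x`.
  -- The form vanishes at this `x`.
  have hid : normSq ((a : ℂ) * x₁ + conj k * x₂) + normSq (k * x₁ + c * x₂) =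
      (normSq k - a * c) * (normSq x₁ + normSq x₂) := by
    have : normSq ((a : ℂ) * x₁ + conj k * x₂) + normSq (k * x₁ + c * x₂) =
      (normSq k - a * c) * (normSq x₁ + normSq x₂) +
      (a + c) * (a * normSq x₁ + c * normSq x₂ + 2 * (k * x₁ * conj x₂).re) := by
      simp [normSq_apply]; ring
    rw [this, hH']; ring
  rw [hid] at hpos
  have := pos_of_mul_pos_left hpos (add_nonneg (normSq_nonneg _) (normSq_nonneg _))
  linarith

end Algebra

/-! ### Bases adapted to two foci -/

/-- Coordinates with the foci of two bisectors as the first two coordinate points: the equation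
of each of the bisectors involves only two of the three coordinates. -/
structure IsAdaptedBasis {V : Type*} [AddCommGroup V] [Module ℂ V]
    (B : V →ₗ[ℂ] V →ₗ⋆[ℂ] ℂ) (h₁ h₂ : V →ₗ[ℂ] V) (e : Module.Basis (Fin 3) ℂ V)
    (a : ℝ) (l : ℂ) (c : ℝ) (d : ℝ) (k : ℂ) (g : ℝ) : Prop where
  ker_left : h₁ (e 0) = 0
  ker_right : h₂ (e 1) = 0
  disc_left : a * c < normSq l
  disc_right : d * g < normSq k
  not_both : ¬ (a = 0 ∧ d = 0)
  form_left : ∀ x y z : ℂ, B (h₁ (x • e 0 + y • e 1 + z • e 2)) (x • e 0 + y • e 1 + z • e 2) =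
    ((a * normSq y + 2 * (l * y * conj z).re + c * normSq z : ℝ) : ℂ)
  form_right : ∀ x y z : ℂ, B (h₂ (x • e 0 + y • e 1 + z • e 2)) (x • e 0 + y • e 1 + z • e 2) =
    ((d * normSq x + 2 * (k * x * conj z).re + g * normSq z : ℝ) : ℂ)

section Frame

variable {V : Type*} [AddCommGroup V] [Module ℂ V] {B : V →ₗ[ℂ] V →ₗ⋆[ℂ] ℂ}

theorem exists_basis_of_not_proportional (hV : Module.finrank ℂ V = 3) {f g : V} (hf : f ≠ 0)
    (hfg : ∀ c : ℂ, c • f ≠ g) : ∃ e : Module.Basis (Fin 3) ℂ V, e 0 = f ∧ e 1 = g := by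
  have : FiniteDimensional ℂ V := Module.finite_of_finrank_pos (by omega)
  have hli : LinearIndependent ℂ ![f, g] := (LinearIndependent.pair_iff' hf).2 hfg
  obtain ⟨w, hw⟩ := exists_linearIndependent_snoc_of_lt_finrank hli (by omega)
  refine ⟨basisOfLinearIndependentOfCardEqFinrank hw (by simp [hV]), ?_, ?_⟩
  · rw [coe_basisOfLinearIndependentOfCardEqFinrank]; rfl
  · rw [coe_basisOfLinearIndependentOfCardEqFinrank]; rfl

theorem exists_isAdaptedBasis (hB : IsHermitianFormPPM B) {h₁ h₂ : V →ₗ[ℂ] V}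
    (hh₁ : GivesBisector B h₁) (hh₂ : GivesBisector B h₂)
    (hslice : ¬ ∃ S : Set (ℙ ℂ V), IsSlice B h₁ S ∧ IsSlice B h₂ S)
    {f₁ f₂ : V} (hf₁ : f₁ ≠ 0) (hf₂ : f₂ ≠ 0) (hk₁ : h₁ f₁ = 0) (hk₂ : h₂ f₂ = 0)
    (h₁₂ : h₁ f₂ ≠ 0) (h₂₁ : h₂ f₁ ≠ 0) :
    ∃ e a l c d k g, IsAdaptedBasis B h₁ h₂ e a l c d k g := by
  have hs := hB.1
  obtain ⟨e, he0, he1⟩ := exists_basis_of_not_proportional (finrank_eq_three hB) hf₁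
    (g := f₂) (fun c hc => h₁₂ (by rw [← hc]; simp [hk₁]))
  have hk₁' : h₁ (e 0) = 0 := by rw [he0, hk₁]
  have hk₂' : h₂ (e 1) = 0 := by rw [he1, hk₂]
  refine ⟨e, (B (h₁ (e 1)) (e 1)).re, B (h₁ (e 1)) (e 2), (B (h₁ (e 2)) (e 2)).re,
    (B (h₂ (e 0)) (e 0)).re, B (h₂ (e 0)) (e 2), (B (h₂ (e 2)) (e 2)).re,
    hk₁', hk₂', ?_, ?_, ?_, ?_, ?_⟩
  · exact discriminant_neg hB hh₁ hk₁' fun x => ⟨_, _, _, basis_decomp e x⟩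
  · refine discriminant_neg hB hh₂ hk₂' fun x => ⟨e.repr x 1, e.repr x 0, e.repr x 2, ?_⟩
    rw [add_comm (_ • e 1)]
    exact basis_decomp e x
  -- If `a = d = 0`, each focus lies on the other bisector, and the line joining the foci is a
  -- common slice.
  · rintro ⟨ha, hd⟩
    rw [he1] at ha
    rw [he0] at hd
    apply hslice
    refine ⟨projLine (Projectivization.mk ℂ f₁ hf₁) (Projectivization.mk ℂ f₂ hf₂), ?_, ?_⟩
    · refine ⟨_, (mk_mem_focusSet hf₁).2 hk₁, _, ⟨(mk_mem_locus hf₂).2 ?_, ?_⟩, rfl⟩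
      · rw [form_apply_self hs hh₁.2.1, ha, ofReal_zero]
      · rwa [mk_mem_focusSet]
    · refine ⟨_, (mk_mem_focusSet hf₂).2 hk₂, _, ⟨(mk_mem_locus hf₁).2 ?_, ?_⟩, ?_⟩
      · rw [form_apply_self hs hh₂.2.1, hd, ofReal_zero]
      · rwa [mk_mem_focusSet]
      · unfold projLine
        rw [sup_comm]
  · intro x y z
    rw [form_expand hs hh₁.2.1, hk₁']
    simp only [map_zero, LinearMap.zero_apply, zero_re, zero_mul, mul_zero, zero_add, add_zero]
    rw [add_right_comm]
  · intro x y z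
    rw [form_expand hs hh₂.2.1, form_apply_conj hs hh₂.2.1 (e 0) (e 1), hk₂']
    simp only [map_zero, LinearMap.zero_apply, zero_re, zero_mul, mul_zero, add_zero]
    rw [add_right_comm]

end Frame

/-! ### Distinctness of the foci -/

section CommonSlice

variable {V : Type*} [AddCommGroup V] [Module ℂ V] {B : V →ₗ[ℂ] V →ₗ⋆[ℂ] ℂ}

/-- Two linear forms on the space of traceless hermitian matrices have a common zero on the cone
of matrices of rank one: every point of the 2-sphere is the image of a point under the Hopf map. -/
theorem exists_common_isotropic (α β : ℝ) (p q : ℂ) :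
    ∃ x y : ℂ, (x ≠ 0 ∨ y ≠ 0) ∧ α * (normSq x - normSq y) + 2 * (p * x * conj y).re = 0 ∧
      β * (normSq x - normSq y) + 2 * (q * x * conj y).re = 0 := by
  have key : ∀ n₁ n₂ n₃ : ℝ, (n₁ ≠ 0 ∨ n₂ ≠ 0 ∨ n₃ ≠ 0) → α * n₁ + p.re * n₂ - p.im * n₃ = 0 →
      β * n₁ + q.re * n₂ - q.im * n₃ = 0 →
      ∃ x y : ℂ, (x ≠ 0 ∨ y ≠ 0) ∧ α * (normSq x - normSq y) + 2 * (p * x * conj y).re = 0 ∧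
        β * (normSq x - normSq y) + 2 * (q * x * conj y).re = 0 := by
    intro n₁ n₂ n₃ hn ha hb
    set r := Real.sqrt (n₁ ^ 2 + n₂ ^ 2 + n₃ ^ 2)
    have hr : r ^ 2 = n₁ ^ 2 + n₂ ^ 2 + n₃ ^ 2 := Real.sq_sqrt (by positivity)
    by_cases h : r + n₁ = 0
    · have h23 : n₂ ^ 2 + n₃ ^ 2 = 0 := by
        linear_combination -hr + (r - n₁) * h
      have h2 : n₂ = 0 := by nlinarith [sq_nonneg n₂, sq_nonneg n₃]
      have h3 : n₃ = 0 := by nlinarith [sq_nonneg n₂, sq_nonneg n₃]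
      have h1 : n₁ ≠ 0 := by simpa [h2, h3] using hn
      have ha' : α = 0 := by simpa [h2, h3, h1] using ha
      have hb' : β = 0 := by simpa [h2, h3, h1] using hb
      exact ⟨1, 0, by simp, by simp [ha'], by simp [hb']⟩
    -- The Hopf image of this pair is `2 * (r + n₁)` times `(n₁, n₂, n₃)`. The lift fails only on
    -- the negative first axis, treated above; there the sign is irrelevant.
    · refine ⟨(r + n₁ : ℝ), ⟨n₂, -n₃⟩, Or.inl (by exact_mod_cast h), ?_, ?_⟩
      · simp [normSq_apply]
        linear_combination 2 * (r + n₁) * ha + α * hr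
      · simp [normSq_apply]
        linear_combination 2 * (r + n₁) * hb + β * hr
  -- The vector sought is orthogonal to `(α, p.re, -p.im)` and `(β, q.re, -q.im)`. Their cross
  -- product, up to sign, serves when its first entry is nonzero; otherwise a vector with first
  -- entry `0` does.
  by_cases hc : p.re * q.im - p.im * q.re = 0
  · by_cases hp : p = 0
    · by_cases hq : q = 0
      · exact ⟨1, 1, by simp, by simp [hp], by simp [hq]⟩
      · refine key 0 q.im q.re ?_ (by simp [hp]) (by ring)
        by_contra! hcon
        exact hq (Complex.ext hcon.2.2 hcon.2.1)
    · refine key 0 p.im p.re ?_ (by ring) (by linarith)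
      by_contra! hcon
      exact hp (Complex.ext hcon.2.2 hcon.2.1)
  · refine key (p.re * q.im - p.im * q.re) (p.im * β - α * q.im) (p.re * β - α * q.re)
      (Or.inl hc) (by ring) (by ring)

theorem exists_orthonormal_of_neg (hB : IsHermitianFormPPM B) {f : V} (hf : (B f f).re < 0) :
    ∃ u v : V, B u u = 1 ∧ B v v = 1 ∧ B u v = 0 ∧ B u f = 0 ∧ B v f = 0 := by
  obtain ⟨hs, b, hb⟩ := hB
  set f₀ := b.repr f 0 with hf₀
  set f₁ := b.repr f 1 with hf₁
  set f₂ := b.repr f 2 with hf₂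
  have hfd : f = f₀ • b 0 + f₁ • b 1 + f₂ • b 2 := basis_decomp b f
  rw [hfd] at hf ⊢
  rw [form_diagonal hb] at hf
  clear_value f₀ f₁ f₂
  simp only [mul_conj, sub_re, add_re, ofReal_re] at hf
  set R := normSq f₀ + normSq f₁ with hR
  by_cases hR0 : R = 0
  · have h0 : f₀ = 0 := normSq_eq_zero.1 (by linarith [normSq_nonneg f₀, normSq_nonneg f₁])
    have h1 : f₁ = 0 := normSq_eq_zero.1 (by linarith [normSq_nonneg f₀, normSq_nonneg f₁])
    refine ⟨b 0, b 1, ?_, ?_, ?_, ?_, ?_⟩ <;> simp [hb, h0, h1]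
  · have hRpos : 0 < R := lt_of_le_of_ne (add_nonneg (normSq_nonneg _) (normSq_nonneg _))
      (Ne.symm hR0)
    have hR' : f₀ * conj f₀ + f₁ * conj f₁ = R := by
      rw [hR, mul_conj, mul_conj]; push_cast; rfl
    have hQ : f₂ * conj f₂ = normSq f₂ := mul_conj f₂
    set Q := normSq f₂
    set S := R * (Q - R) with hS
    have hSpos : 0 < S := mul_pos hRpos (by linarith)
    set ρ := (Real.sqrt R)⁻¹
    set σ := (Real.sqrt S)⁻¹
    have hρ : (ρ : ℂ) * ρ * R = 1 := by
      have : ρ * ρ * R = 1 := by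
        rw [← mul_inv, Real.mul_self_sqrt hRpos.le, inv_mul_cancel₀ hR0]
      exact_mod_cast this
    have hσ : (σ : ℂ) * σ * (R * (Q - R)) = 1 := by
      have : σ * σ * S = 1 := by
        rw [← mul_inv, Real.mul_self_sqrt hSpos.le, inv_mul_cancel₀ hSpos.ne']
      rw [hS] at this
      exact_mod_cast this
    -- The first vector is orthogonal to the positive part of `f` inside the positive plane. The
    -- second combines that positive part with `b 2`; before scaling by `σ`, its square is `R * (Q -
    -- R)`.
    refine ⟨(-ρ * conj f₁) • b 0 + (ρ * conj f₀) • b 1 + (0 : ℂ) • b 2,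
      (σ * conj f₂ * f₀) • b 0 + (σ * conj f₂ * f₁) • b 1 + ((σ : ℂ) * R) • b 2, ?_, ?_, ?_, ?_, ?_⟩
    all_goals rw [form_diagonal hb]
    · simp only [map_mul, map_neg, conj_conj, conj_ofReal, map_zero]
      linear_combination hρ + ρ * ρ * hR'
    · simp only [map_mul, conj_conj, conj_ofReal]
      linear_combination hσ + σ * σ * f₂ * conj f₂ * hR' + σ * σ * R * hQ
    · simp only [map_mul, conj_conj, conj_ofReal]
      ring
    · ring
    · linear_combination σ * conj f₂ * hR'

/-- Two bisectors with a common negative focus have a common slice. -/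
theorem exists_common_isotropic_of_neg_focus (hB : IsHermitianFormPPM B) {h₁ h₂ : V →ₗ[ℂ] V}
    (hs₁ : ∀ x y : V, B (h₁ x) y = B x (h₁ y)) (hs₂ : ∀ x y : V, B (h₂ x) y = B x (h₂ y))
    (ht₁ : LinearMap.trace ℂ V h₁ = 0) (ht₂ : LinearMap.trace ℂ V h₂ = 0)
    {f : V} (hf : (B f f).re < 0) (hf₁ : h₁ f = 0) (hf₂ : h₂ f = 0) :
    ∃ x : V, (∀ c : ℂ, c • f ≠ x) ∧ B (h₁ x) x = 0 ∧ B (h₂ x) x = 0 := by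
  obtain ⟨u, v, huu, hvv, huv, huf, hvf⟩ := exists_orthonormal_of_neg hB hf
  have hs := hB.1
  have hvu : B v u = 0 := by rw [hs, huv, star_zero]
  have hfu : B f u = 0 := by rw [hs, huf, star_zero]
  have hfv : B f v = 0 := by rw [hs, hvf, star_zero]
  have hff : B f f ≠ 0 := fun h => by rw [h] at hf; simp at hf
  have hli : LinearIndependent ℂ ![u, v, f] := by
    rw [Fintype.linearIndependent_iff]
    intro w hw
    rw [Fin.sum_univ_three] at hw
    have h0 := congrArg (fun x => B x u) hw
    have h1 := congrArg (fun x => B x v) hw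
    have h2 := congrArg (fun x => B x f) hw
    simp [huu, hvv, huv, huf, hvf, hvu, hfu, hfv, hff] at h0 h1 h2
    intro i
    fin_cases i <;> assumption
  let e := basisOfLinearIndependentOfCardEqFinrank hli (by simp [finrank_eq_three hB])
  have he0 : e 0 = u := by
    change basisOfLinearIndependentOfCardEqFinrank _ _ _ = _
    rw [coe_basisOfLinearIndependentOfCardEqFinrank]; rfl
  have he1 : e 1 = v := by
    change basisOfLinearIndependentOfCardEqFinrank _ _ _ = _
    rw [coe_basisOfLinearIndependentOfCardEqFinrank]; rfl
  have he2 : e 2 = f := by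
    change basisOfLinearIndependentOfCardEqFinrank _ _ _ = _
    rw [coe_basisOfLinearIndependentOfCardEqFinrank]; rfl
  have hr0 : ∀ x, e.repr x 0 = B x u := by
    intro x
    conv_rhs => rw [basis_decomp e x, he0, he1, he2]
    simp [huu, hvu, hfu]
  have hr1 : ∀ x, e.repr x 1 = B x v := by
    intro x
    conv_rhs => rw [basis_decomp e x, he0, he1, he2]
    simp [hvv, huv, hfv]
  -- This is where tracelessness enters: `f` contributes nothing, so the values of the form at `u`
  -- and `v` are opposite.
  have htr : ∀ h : V →ₗ[ℂ] V, h f = 0 → LinearMap.trace ℂ V h = B (h u) u + B (h v) v := by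
    intro h hhf
    rw [LinearMap.trace_eq_matrix_trace ℂ e, Matrix.trace, Fin.sum_univ_three]
    simp only [Matrix.diag_apply, LinearMap.toMatrix_apply, he0, he1, he2, hr0, hr1, hhf]
    simp
  have hform : ∀ h : V →ₗ[ℂ] V, (∀ x y : V, B (h x) y = B x (h y)) → h f = 0 →
      LinearMap.trace ℂ V h = 0 → ∀ x y : ℂ, B (h (x • u + y • v)) (x • u + y • v) =
        (((B (h u) u).re * (normSq x - normSq y) + 2 * (B (h u) v * x * conj y).re : ℝ) : ℂ) := by
    intro h hh hhf ht x y
    rw [htr h hhf] at ht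
    have h1 := form_expand hs hh f u v 0 x y
    have h2 : (B (h v) v).re = -(B (h u) u).re := by
      have := congrArg Complex.re ht
      simp at this
      linarith
    rw [hhf, h2] at h1
    simp only [zero_smul, zero_add] at h1
    rw [h1]
    congr 1
    simp
    ring
  obtain ⟨x, y, hxy, hx1, hx2⟩ := exists_common_isotropic (B (h₁ u) u).re (B (h₂ u) u).re
    (B (h₁ u) v) (B (h₂ u) v)
  refine ⟨x • u + y • v, ?_, ?_, ?_⟩
  · intro c hc
    have h0 := congrArg (fun x => B x u) hc
    have h1 := congrArg (fun x => B x v) hc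
    simp [huu, hvv, huv, hvu, hfu, hfv] at h0 h1
    rcases hxy with h | h
    · exact h h0.symm
    · exact h h1.symm
  · rw [hform h₁ hs₁ hf₁ ht₁, hx1, ofReal_zero]
  · rw [hform h₂ hs₂ hf₂ ht₂, hx2, ofReal_zero]

/-- Bisectors that meet in the ball and have no common slice have different foci. -/
theorem apply_focus_ne_zero (hB : IsHermitianFormPPM B) {h₁ h₂ : V →ₗ[ℂ] V}
    (hh₁ : GivesBisector B h₁) (hh₂ : GivesBisector B h₂)
    (hslice : ¬ ∃ S : Set (ℙ ℂ V), IsSlice B h₁ S ∧ IsSlice B h₂ S)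
    (hD : (locus B h₁ ∩ locus B h₂ ∩ ball B).Nonempty)
    {f₁ f₂ : V} (hf₁ : f₁ ≠ 0) (hf₂ : f₂ ≠ 0) (hk₁ : h₁ f₁ = 0) (hk₂ : h₂ f₂ = 0)
    (hu₁ : ∀ x, h₁ x = 0 → ∃ c : ℂ, c • f₁ = x) (hu₂ : ∀ x, h₂ x = 0 → ∃ c : ℂ, c • f₂ = x) :
    h₁ f₂ ≠ 0 := by
  intro h₁₂
  obtain ⟨c, rfl⟩ := hu₁ f₂ h₁₂
  have hc : c ≠ 0 := by rintro rfl; simp at hf₂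
  have h₂₁ : h₂ f₁ = 0 := by simpa [hc] using hk₂
  have key : ∀ x : V, (∀ s : ℂ, s • f₁ ≠ x) → B (h₁ x) x = 0 → B (h₂ x) x = 0 → False := by
    intro x hx hx1 hx2
    have hx0 : x ≠ 0 := fun h => hx 0 (by simp [h])
    have hn1 : h₁ x ≠ 0 := fun h => by
      obtain ⟨s, hs⟩ := hu₁ x h
      exact hx s hs
    have hn2 : h₂ x ≠ 0 := fun h => by
      obtain ⟨s, hs⟩ := hu₂ x h
      exact hx (s * c) (by rw [mul_smul, hs])
    apply hslice
    refine ⟨projLine (Projectivization.mk ℂ f₁ hf₁) (Projectivization.mk ℂ x hx0), ?_, ?_⟩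
    · exact ⟨_, (mk_mem_focusSet hf₁).2 hk₁, _, ⟨(mk_mem_locus hx0).2 hx1,
        fun h => hn1 ((mk_mem_focusSet hx0).1 h)⟩, rfl⟩
    · exact ⟨_, (mk_mem_focusSet hf₁).2 h₂₁, _, ⟨(mk_mem_locus hx0).2 hx2,
        fun h => hn2 ((mk_mem_focusSet hx0).1 h)⟩, rfl⟩
  obtain ⟨p, ⟨hp1, hp2⟩, hp3⟩ := hD
  by_cases hp : ∃ s : ℂ, s • f₁ = p.rep
  · obtain ⟨s, hs⟩ := hp
    have hs0 : s ≠ 0 := by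
      rintro rfl
      exact p.rep_nonzero (by rw [← hs]; simp)
    have k1 : h₁ p.rep = 0 := by rw [← hs]; simp [hk₁]
    have k2 : h₂ p.rep = 0 := by rw [← hs]; simp [h₂₁]
    obtain ⟨x, hx, hx1, hx2⟩ := exists_common_isotropic_of_neg_focus hB hh₁.2.1 hh₂.2.1
      hh₁.2.2.1 hh₂.2.2.1 hp3 k1 k2
    refine key x (fun t ht => hx (t / s) ?_) hx1 hx2
    rw [← hs, smul_smul, div_mul_cancel₀ _ hs0, ht]
  · push Not at hp
    exact key p.rep hp hp1 hp2

theorem exists_isAdaptedBasis_of_nonempty (hB : IsHermitianFormPPM B) {h₁ h₂ : V →ₗ[ℂ] V}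
    (hh₁ : GivesBisector B h₁) (hh₂ : GivesBisector B h₂)
    (hslice : ¬ ∃ S : Set (ℙ ℂ V), IsSlice B h₁ S ∧ IsSlice B h₂ S)
    (hD : (locus B h₁ ∩ locus B h₂ ∩ ball B).Nonempty) :
    ∃ e a l c d k g, IsAdaptedBasis B h₁ h₂ e a l c d k g := by
  obtain ⟨f₁, hf₁, hk₁, hu₁⟩ := exists_generator_ker (finrank_eq_three hB) hh₁.1
  obtain ⟨f₂, hf₂, hk₂, hu₂⟩ := exists_generator_ker (finrank_eq_three hB) hh₂.1
  refine exists_isAdaptedBasis hB hh₁ hh₂ hslice hf₁ hf₂ hk₁ hk₂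
    (apply_focus_ne_zero hB hh₁ hh₂ hslice hD hf₁ hf₂ hk₁ hk₂ hu₁ hu₂)
    (apply_focus_ne_zero hB hh₂ hh₁ ?_ ?_ hf₂ hf₁ hk₂ hk₁ hu₂ hu₁)
  · rintro ⟨S, h, h'⟩
    exact hslice ⟨S, h', h⟩
  · rwa [Set.inter_comm (locus B h₂)]

end CommonSlice

/-! ### The topology of the projective plane -/

theorem isOpen_cone {V : Type*} [AddCommGroup V] [Module ℂ V] [TopologicalSpace V] [T2Space V]
    {O : Set (ℙ ℂ V)} (hO : IsOpen O) :
    IsOpen {v : V | ∃ hv : v ≠ 0, Projectivization.mk ℂ v hv ∈ O} := by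
  have h1 : IsOpen ((fun v : {v : V // v ≠ 0} => Projectivization.mk' ℂ v) ⁻¹' O) :=
    isOpen_coinduced.1 hO
  have h2 : IsOpen {v : V | v ≠ 0} := isOpen_ne
  have h3 := h2.isOpenMap_subtype_val _ h1
  convert h3 using 1
  ext v
  constructor
  · rintro ⟨hv, hvO⟩
    exact ⟨⟨v, hv⟩, hvO, rfl⟩
  · rintro ⟨⟨w, hw⟩, hwO, rfl⟩
    exact ⟨hw, hwO⟩

section Topological

variable {V : Type*} [AddCommGroup V] [Module ℂ V] [TopologicalSpace V]
  [IsTopologicalAddGroup V] [ContinuousSMul ℂ V] [T2Space V] {B : V →ₗ[ℂ] V →ₗ⋆[ℂ] ℂ}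

theorem continuous_form_self (hB : IsHermitianFormPPM B) : Continuous fun v => (B v v).re := by
  obtain ⟨-, b, hb⟩ := hB
  have : FiniteDimensional ℂ V := b.finiteDimensional_of_finite
  have hc : ∀ i, Continuous fun v => b.repr v i := fun i =>
    (b.coord i).continuous_of_finiteDimensional
  have h : (fun v => (B v v).re) =
      fun v => normSq (b.repr v 0) + normSq (b.repr v 1) - normSq (b.repr v 2) := by
    ext v
    conv_lhs => rw [basis_decomp b v, form_diagonal hb]
    simp [mul_conj]
  rw [h]
  have h0 := hc 0
  have h1 := hc 1
  have h2 := hc 2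
  exact ((continuous_normSq.comp h0).add (continuous_normSq.comp h1)).sub
    (continuous_normSq.comp h2)

theorem isOpen_ball (hB : IsHermitianFormPPM B) : IsOpen (ball B) := by
  refine isOpen_coinduced.2 ?_
  have h : IsOpen {v : {v : V // v ≠ 0} | (B (v : V) v).re < 0} :=
    isOpen_lt ((continuous_form_self hB).comp continuous_subtype_val) continuous_const
  convert h using 1
  ext v
  exact mk_mem_ball v.2

theorem isOpen_affineChart_preimage {O : Set (ℙ ℂ V)} (hO : IsOpen O)
    (e : Module.Basis (Fin 3) ℂ V) : IsOpen (affineChart e ⁻¹' O) := by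
  have h : Continuous fun z : ℂ × ℂ => z.1 • e 0 + z.2 • e 1 + e 2 := by fun_prop
  convert (isOpen_cone hO).preimage h using 1
  ext z
  exact ⟨fun hz => ⟨affine_ne_zero e z, hz⟩, fun ⟨_, hz⟩ => hz⟩

/-- For `u` at infinity and `w` with a nonzero last coordinate, this moves a point into the affine
chart without leaving `O`. -/
theorem exists_mk_add_smul_mem {O : Set (ℙ ℂ V)} (hO : IsOpen O) {u : V} (hu : u ≠ 0)
    (huO : Projectivization.mk ℂ u hu ∈ O) (w : V) :
    ∃ t : ℝ, t ≠ 0 ∧ ∃ h : u + (t : ℂ) • w ≠ 0, Projectivization.mk ℂ _ h ∈ O := by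
  have hc : Continuous fun t : ℝ => u + (t : ℂ) • w := by fun_prop
  have hopen := (isOpen_cone hO).preimage hc
  have h0 : (0 : ℝ) ∈ (fun t : ℝ => u + (t : ℂ) • w) ⁻¹'
      {v : V | ∃ hv : v ≠ 0, Projectivization.mk ℂ v hv ∈ O} := by
    simpa using ⟨hu, huO⟩
  obtain ⟨ε, hε, hball⟩ := Metric.isOpen_iff.1 hopen 0 h0
  refine ⟨ε / 2, by positivity, hball ?_⟩
  rw [Metric.mem_ball, Real.dist_0_eq_abs, abs_of_pos (by positivity)]
  linarith

end Topological

/-! ### The intersection in an adapted chart -/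

theorem affineChart_div {V : Type*} [AddCommGroup V] [Module ℂ V]
    (e : Module.Basis (Fin 3) ℂ V) {x y z : ℂ} (hz : z ≠ 0) {v : V}
    (hv : v ≠ 0) (h : v = x • e 0 + y • e 1 + z • e 2) :
    affineChart e (x / z, y / z) = Projectivization.mk ℂ v hv := by
  rw [affineChart, Projectivization.mk_eq_mk_iff']
  refine ⟨z⁻¹, ?_⟩
  rw [h, smul_add, smul_add, smul_smul, smul_smul, smul_smul, inv_mul_cancel₀ hz, one_smul,
    div_eq_inv_mul, div_eq_inv_mul]

namespace IsAdaptedBasis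

variable {V : Type*} [AddCommGroup V] [Module ℂ V] {B : V →ₗ[ℂ] V →ₗ⋆[ℂ] ℂ}
  {h₁ h₂ : V →ₗ[ℂ] V} {e : Module.Basis (Fin 3) ℂ V} {a : ℝ} {l : ℂ} {c : ℝ} {d : ℝ}
  {k : ℂ} {g : ℝ}

theorem affineChart_mem_left (H : IsAdaptedBasis B h₁ h₂ e a l c d k g) (z : ℂ × ℂ) :
    affineChart e z ∈ locus B h₁ ↔ circleFn a l c z.2 = 0 := by
  have h := H.form_left z.1 z.2 1
  rw [one_smul] at h
  rw [affineChart, mk_mem_locus, h, ofReal_eq_zero]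
  simp [circleFn]

theorem affineChart_mem_right (H : IsAdaptedBasis B h₁ h₂ e a l c d k g) (z : ℂ × ℂ) :
    affineChart e z ∈ locus B h₂ ↔ circleFn d k g z.1 = 0 := by
  have h := H.form_right z.1 z.2 1
  rw [one_smul] at h
  rw [affineChart, mk_mem_locus, h, ofReal_eq_zero]
  simp [circleFn]

end IsAdaptedBasis

namespace IsAdaptedBasis

section Algebra

variable {V : Type*} [AddCommGroup V] [Module ℂ V] {B : V →ₗ[ℂ] V →ₗ⋆[ℂ] ℂ}
  {h₁ h₂ : V →ₗ[ℂ] V} {e : Module.Basis (Fin 3) ℂ V} {a : ℝ} {l : ℂ} {c : ℝ} {d : ℝ}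
  {k : ℂ} {g : ℝ}

/-- The common points of two bisectors at infinity of an adapted chart are foci. -/
theorem eq_smul_of_mem (H : IsAdaptedBasis B h₁ h₂ e a l c d k g) {v : V}
    (hv₁ : B (h₁ v) v = 0) (hv₂ : B (h₂ v) v = 0) (hz : e.repr v 2 = 0) :
    (a = 0 ∧ d ≠ 0 ∧ v = e.repr v 1 • e 1) ∨ (d = 0 ∧ a ≠ 0 ∧ v = e.repr v 0 • e 0) ∨ v = 0 := by
  have hv := basis_decomp e v
  set x := e.repr v 0
  set y := e.repr v 1
  rw [hz] at hv
  rw [hv, H.form_left, ofReal_eq_zero] at hv₁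
  rw [hv, H.form_right, ofReal_eq_zero] at hv₂
  simp at hv₁ hv₂
  have hnot := H.not_both
  rcases hv₁ with ha | hy
  · have hd : d ≠ 0 := fun hd => hnot ⟨ha, hd⟩
    have hx : x = 0 := hv₂.resolve_left hd
    left
    refine ⟨ha, hd, ?_⟩
    rw [hx] at hv
    simpa using hv
  · rcases hv₂ with hd | hx
    · have ha : a ≠ 0 := fun ha => hnot ⟨ha, hd⟩
      right; left
      refine ⟨hd, ha, ?_⟩
      rw [hy] at hv
      simpa using hv
    · right; right
      rw [hv, hx, hy]
      simp

/-- A degenerate combination of the two forms has prescribed ratio of coefficients. -/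
theorem ratio_of_kernel (H : IsAdaptedBasis B h₁ h₂ e a l c d k g) {s t : ℝ} (hs : s ≠ 0)
    (ht : t ≠ 0) {x y z : ℂ} (hne : ¬ (x = 0 ∧ y = 0 ∧ z = 0))
    (e₀ : (s * d : ℝ) * x + conj (s * k) * z = 0) (e₁ : (t * a : ℝ) * y + conj (t * l) * z = 0)
    (e₂ : s * k * x + t * l * y + (s * g + t * c : ℝ) * z = 0) :
    s * (a * (d * g - normSq k)) + t * (d * (a * c - normSq l)) = 0 := by
  have hs' : (s : ℂ) ≠ 0 := by exact_mod_cast hs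
  have ht' : (t : ℂ) ≠ 0 := by exact_mod_cast ht
  have hl := H.disc_left
  have hk := H.disc_right
  simp only [map_mul, conj_ofReal] at e₀ e₁
  push_cast at e₀ e₁ e₂
  have e₀' : (d : ℂ) * x + conj k * z = 0 := by
    refine (mul_eq_zero.1 (?_ : (s : ℂ) * _ = 0)).resolve_left hs'
    linear_combination e₀
  have e₁' : (a : ℂ) * y + conj l * z = 0 := by
    refine (mul_eq_zero.1 (?_ : (t : ℂ) * _ = 0)).resolve_left ht'
    linear_combination e₁
  -- With `z = 0`, the kernel vector would be proportional to `e 0` or `e 1`, and the third row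
  -- would then make one discriminant vanish.
  have hz : z ≠ 0 := by
    rintro rfl
    simp at e₀' e₁' e₂ hne
    by_cases hd : d = 0
    · have ha : a ≠ 0 := fun ha => H.not_both ⟨ha, hd⟩
      have hy : y = 0 := e₁'.resolve_left ha
      have hx : x ≠ 0 := fun hx => hne hx hy
      have hk0 : k = 0 := by simpa [hy, hs, hx] using e₂
      simp [hd, hk0] at hk
    · have hx : x = 0 := e₀'.resolve_left hd
      have hy : y ≠ 0 := hne hx
      have ha : a = 0 := e₁'.resolve_right hy
      have hl0 : l = 0 := by simpa [hx, ht, hy] using e₂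
      simp [ha, hl0] at hl
  have key : ((s * (a * (d * g - normSq k)) + t * (d * (a * c - normSq l)) : ℝ) : ℂ) * z = 0 := by
    push_cast
    rw [← mul_conj, ← mul_conj]
    -- The first two rows eliminate `x` and `y` from the third.
    linear_combination a * d * e₂ - s * k * a * e₀' - t * l * d * e₁'
  exact_mod_cast (mul_eq_zero.1 key).resolve_right hz

/-- The linear equation in `(s, t)` is nontrivial, since the discriminants are nonzero and `a`, `d`
do not both vanish. Its solutions therefore form a line. -/
theorem ratio_unique (H : IsAdaptedBasis B h₁ h₂ e a l c d k g) {s t s' t' : ℝ}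
    (h : s * (a * (d * g - normSq k)) + t * (d * (a * c - normSq l)) = 0)
    (h' : s' * (a * (d * g - normSq k)) + t' * (d * (a * c - normSq l)) = 0) :
    s * t' = s' * t := by
  by_cases ha : a = 0
  · have hd : d ≠ 0 := fun hd => H.not_both ⟨ha, hd⟩
    have hnz : d * (a * c - normSq l) ≠ 0 := mul_ne_zero hd (by linarith [H.disc_left])
    apply mul_right_cancel₀ hnz
    linear_combination s * h' - s' * h
  · have hnz : a * (d * g - normSq k) ≠ 0 := mul_ne_zero ha (by linarith [H.disc_right])
    apply mul_right_cancel₀ hnz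
    linear_combination t' * h - t * h'

theorem form_of_gram (H : IsAdaptedBasis B h₁ h₂ e a l c d k g)
    (hs : ∀ x y : V, B x y = star (B y x)) {h : V →ₗ[ℂ] V}
    (hh : ∀ x y : V, B (h x) y = B x (h y)) {s t : ℝ}
    (e₀ : (B (h (e 0)) (e 0)).re = s * d) (e₀₂ : B (h (e 0)) (e 2) = s * k)
    (e₁ : (B (h (e 1)) (e 1)).re = t * a) (e₁₂ : B (h (e 1)) (e 2) = t * l)
    (e₂ : (B (h (e 2)) (e 2)).re = s * g + t * c) (e₀₁ : B (h (e 0)) (e 1) = 0) (v : V) :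
    B (h v) v = s * B (h₂ v) v + t * B (h₁ v) v := by
  rw [basis_decomp e v, form_expand hs hh, H.form_left, H.form_right, e₀, e₁, e₂, e₀₁, e₀₂, e₁₂,
    ← ofReal_mul, ← ofReal_mul, ← ofReal_add]
  congr 1
  rw [mul_assoc (s : ℂ), mul_assoc (s : ℂ), re_ofReal_mul, mul_assoc (t : ℂ), mul_assoc (t : ℂ),
    re_ofReal_mul]
  simp only [zero_mul, zero_re]
  ring

end Algebra

section Topological

variable {V : Type*} [AddCommGroup V] [Module ℂ V] [TopologicalSpace V]
  [IsTopologicalAddGroup V] [ContinuousSMul ℂ V] [T2Space V] {B : V →ₗ[ℂ] V →ₗ⋆[ℂ] ℂ}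
  {h₁ h₂ : V →ₗ[ℂ] V} {e : Module.Basis (Fin 3) ℂ V} {a : ℝ} {l : ℂ} {c : ℝ} {d : ℝ}
  {k : ℂ} {g : ℝ}

/-- The points of the intersection of the bisectors in an adapted affine chart are dense. -/
theorem exists_affineChart_mem (H : IsAdaptedBasis B h₁ h₂ e a l c d k g) {O : Set (ℙ ℂ V)}
    (hO : IsOpen O) {p : ℙ ℂ V} (hp₁ : p ∈ locus B h₁) (hp₂ : p ∈ locus B h₂) (hpO : p ∈ O) :
    ∃ z : ℂ × ℂ, affineChart e z ∈ O ∧ circleFn d k g z.1 = 0 ∧ circleFn a l c z.2 = 0 := by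
  induction p using Projectivization.ind with
  | h v hv =>
    by_cases hz : e.repr v 2 = 0
    · rcases H.eq_smul_of_mem ((mk_mem_locus hv).1 hp₁) ((mk_mem_locus hv).1 hp₂) hz with
        ⟨ha, hd, hy⟩ | ⟨hd, ha, hx⟩ | h
      · have hl : l ≠ 0 := by
          rintro rfl
          simpa [ha] using H.disc_left
        obtain ⟨w, hw⟩ := exists_circleFn_eq_zero H.disc_right hd
        have hu : (I / l) • e 1 ≠ 0 := smul_ne_zero (div_ne_zero I_ne_zero hl) (e.ne_zero 1)
        have huv : Projectivization.mk ℂ _ hu = Projectivization.mk ℂ v hv := by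
          rw [Projectivization.mk_eq_mk_iff']
          have hy0 : e.repr v 1 ≠ 0 := fun h0 => hv (by rw [hy, h0, zero_smul])
          refine ⟨(I / l) / e.repr v 1, ?_⟩
          conv_lhs => rw [hy]
          rw [smul_smul]
          simp [hy0]
        -- The point at infinity is `e 1`. The approach keeps the first affine coordinate at `w` on
        -- its circle, while the second runs to infinity along its line, as in `circleFn_zero_line`.
        obtain ⟨t, ht, h0, hmem⟩ := exists_mk_add_smul_mem hO hu (by rwa [huv])
          (w • e 0 + (-(c / 2) / l) • e 1 + e 2)
        have ht' : (t : ℂ) ≠ 0 := by exact_mod_cast ht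
        refine ⟨((t * w) / t, (I / l + t * (-(c / 2) / l)) / t), ?_, ?_, ?_⟩
        · rwa [affineChart_div e ht' h0 (by module)]
        · simpa [ht'] using hw
        · simpa [ha] using circleFn_zero_line hl c ht
      · have hk : k ≠ 0 := by
          rintro rfl
          simpa [hd] using H.disc_right
        obtain ⟨w, hw⟩ := exists_circleFn_eq_zero H.disc_left ha
        have hu : (I / k) • e 0 ≠ 0 := smul_ne_zero (div_ne_zero I_ne_zero hk) (e.ne_zero 0)
        have huv : Projectivization.mk ℂ _ hu = Projectivization.mk ℂ v hv := by
          rw [Projectivization.mk_eq_mk_iff']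
          have hy0 : e.repr v 0 ≠ 0 := fun h0 => hv (by rw [hx, h0, zero_smul])
          refine ⟨(I / k) / e.repr v 0, ?_⟩
          conv_lhs => rw [hx]
          rw [smul_smul]
          simp [hy0]
        obtain ⟨t, ht, h0, hmem⟩ := exists_mk_add_smul_mem hO hu (by rwa [huv])
          ((-(g / 2) / k) • e 0 + w • e 1 + e 2)
        have ht' : (t : ℂ) ≠ 0 := by exact_mod_cast ht
        refine ⟨((I / k + t * (-(g / 2) / k)) / t, (t * w) / t), ?_, ?_, ?_⟩
        · rwa [affineChart_div e ht' h0 (by module)]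
        · simpa [hd] using circleFn_zero_line hk g ht
        · simpa [ht'] using hw
      · exact absurd h hv
    · refine ⟨(e.repr v 0 / e.repr v 2, e.repr v 1 / e.repr v 2), ?_⟩
      rw [← H.affineChart_mem_left, ← H.affineChart_mem_right,
        affineChart_div e hz hv (basis_decomp e v)]
      exact ⟨hpO, hp₂, hp₁⟩

theorem isSmoothSurface (H : IsAdaptedBasis B h₁ h₂ e a l c d k g) {O S : Set (ℙ ℂ V)}
    (hO : IsOpen O) (hS : S ⊆ Set.range (affineChart e))
    (hmem : ∀ z, affineChart e z ∈ S ↔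
      affineChart e z ∈ locus B h₁ ∩ locus B h₂ ∩ O) : IsSmoothSurface S := by
  intro p hp
  obtain ⟨z, rfl⟩ := hS hp
  have hz := (hmem z).1 hp
  have hz₁ := (H.affineChart_mem_left z).1 hz.1.1
  have hz₂ := (H.affineChart_mem_right z).1 hz.1.2
  -- Discarding the zeros of the two gradients makes the map a submersion on the whole
  -- neighbourhood; no point of the surface is lost.
  refine ⟨e, affineChart e ⁻¹' O ∩
    ({z : ℂ × ℂ | d * conj z.1 + k ≠ 0} ∩ {z : ℂ × ℂ | a * conj z.2 + l ≠ 0}),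
    fun z => (circleFn d k g z.1, circleFn a l c z.2), ?_, ⟨z, ⟨hz.2, ?_, ?_⟩, rfl⟩, ?_, ?_, ?_⟩
  · refine (isOpen_affineChart_preimage hO e).inter (IsOpen.inter ?_ ?_)
    · exact isOpen_ne_fun (by fun_prop) continuous_const
    · exact isOpen_ne_fun (by fun_prop) continuous_const
  · exact circleFn_gradient_ne_zero H.disc_right hz₂
  · exact circleFn_gradient_ne_zero H.disc_left hz₁
  · exact (((contDiff_circleFn d k g).comp contDiff_fst).prodMk
      ((contDiff_circleFn a l c).comp contDiff_snd)).contDiffOn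
  · rintro w ⟨-, hw₂, hw₁⟩
    exact surjective_fderiv_prod_circleFn hw₂ hw₁
  · rintro w ⟨hwO, -⟩
    rw [hmem, Set.mem_inter_iff, Set.mem_inter_iff, H.affineChart_mem_left,
      H.affineChart_mem_right, Prod.mk_eq_zero]
    exact ⟨fun h => ⟨h.1.2, h.1.1⟩, fun h => ⟨⟨h.2, h.1⟩, hwO⟩⟩

/-- A selfadjoint map whose form vanishes on a nonempty open part of the intersection of the two
bisectors is a combination of the two given maps. -/
theorem gram_of_vanishing (H : IsAdaptedBasis B h₁ h₂ e a l c d k g)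
    (hs : ∀ x y : V, B x y = star (B y x)) {h : V →ₗ[ℂ] V}
    (hh : ∀ x y : V, B (h x) y = B x (h y)) {O : Set (ℙ ℂ V)} (hO : IsOpen O)
    (hne : (locus B h₁ ∩ locus B h₂ ∩ O).Nonempty)
    (hsub : locus B h₁ ∩ locus B h₂ ∩ O ⊆ locus B h) :
    ∃ s t : ℝ, (B (h (e 0)) (e 0)).re = s * d ∧ B (h (e 0)) (e 2) = s * k ∧
      (B (h (e 1)) (e 1)).re = t * a ∧ B (h (e 1)) (e 2) = t * l ∧
      (B (h (e 2)) (e 2)).re = s * g + t * c ∧ B (h (e 0)) (e 1) = 0 := by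
  obtain ⟨p, ⟨hp₁, hp₂⟩, hpO⟩ := hne
  obtain ⟨z, hzO, hz₂, hz₁⟩ := H.exists_affineChart_mem hO hp₁ hp₂ hpO
  obtain ⟨M, hM, N, hN, hMN⟩ := mem_nhds_prod_iff.1
    ((isOpen_affineChart_preimage hO e).mem_nhds hzO)
  refine product_arcs_rigidity H.disc_left H.disc_right H.not_both hz₂ hz₁ hM hN ?_
  intro x hx y hy hx0 hy0
  have hO' : affineChart e (x, y) ∈ O := hMN (Set.mk_mem_prod hx hy)
  have hmem := hsub ⟨⟨(H.affineChart_mem_left (x, y)).2 hy0,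
    (H.affineChart_mem_right (x, y)).2 hx0⟩, hO'⟩
  have h1 := form_expand hs hh (e 0) (e 1) (e 2) x y 1
  rw [one_smul, (mk_mem_locus (affine_ne_zero e (x, y))).1 hmem] at h1
  have h2 := (ofReal_eq_zero.1 h1.symm)
  simp only [map_one, mul_one] at h2
  linarith

/-- The bisectors containing a nonempty open part of the intersection of two given ones are given
by a combination of their forms, with a prescribed ratio of coefficients unless one of these
vanishes. -/
theorem exists_combination (H : IsAdaptedBasis B h₁ h₂ e a l c d k g)
    (hB : IsHermitianFormPPM B) {h : V →ₗ[ℂ] V} (hg : GivesBisector B h) {O : Set (ℙ ℂ V)}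
    (hO : IsOpen O) (hne : (locus B h₁ ∩ locus B h₂ ∩ O).Nonempty)
    (hsub : locus B h₁ ∩ locus B h₂ ∩ O ⊆ locus B h) :
    ∃ s t : ℝ, (∀ v, B (h v) v = s * B (h₂ v) v + t * B (h₁ v) v) ∧ (s ≠ 0 ∨ t ≠ 0) ∧
      (s ≠ 0 → t ≠ 0 → s * (a * (d * g - normSq k)) + t * (d * (a * c - normSq l)) = 0) := by
  have hs := hB.1
  have hh := hg.2.1
  obtain ⟨s, t, e₀, e₀₂, e₁, e₁₂, e₂, e₀₁⟩ := H.gram_of_vanishing hs hh hO hne hsub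
  have f₀ : B (h (e 0)) (e 0) = (s * d : ℝ) := by rw [form_apply_self hs hh, e₀]
  have f₁ : B (h (e 1)) (e 1) = (t * a : ℝ) := by rw [form_apply_self hs hh, e₁]
  have f₂ : B (h (e 2)) (e 2) = (s * g + t * c : ℝ) := by rw [form_apply_self hs hh, e₂]
  have f₁₀ : B (h (e 1)) (e 0) = 0 := by rw [form_apply_conj hs hh, e₀₁, map_zero]
  have f₂₀ : B (h (e 2)) (e 0) = conj (s * k) := by rw [form_apply_conj hs hh, e₀₂]
  have f₂₁ : B (h (e 2)) (e 1) = conj (t * l) := by rw [form_apply_conj hs hh, e₁₂]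
  refine ⟨s, t, H.form_of_gram hs hh e₀ e₀₂ e₁ e₁₂ e₂ e₀₁, ?_, ?_⟩
  -- If both coefficients vanished, the Gram matrix of `h` would be zero, hence `h = 0` by
  -- nondegeneracy of `B`.
  · by_contra! hst
    obtain ⟨x, -, hx⟩ := exists_isotropic hg
    apply hx
    apply eq_zero_of_form_eq_zero hB
    intro y
    rw [hst.1] at f₀ f₂ f₂₀ e₀₂
    rw [hst.2] at f₁ f₂ f₂₁ e₁₂
    rw [basis_decomp e x, basis_decomp e y]
    simp [f₀, f₁, f₂, f₁₀, f₂₀, f₂₁, e₀₁, e₀₂, e₁₂]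
  · intro hs0 ht0
    -- Since `h` has rank two it kills some `f ≠ 0`; pairing `h f` with the three basis vectors
    -- gives the rows required by `ratio_of_kernel`.
    obtain ⟨f, hf, hhf, -⟩ := exists_generator_ker (finrank_eq_three hB) hg.1
    have hd := basis_decomp e f
    refine H.ratio_of_kernel hs0 ht0 (x := e.repr f 0) (y := e.repr f 1) (z := e.repr f 2)
      ?_ ?_ ?_ ?_
    · rintro ⟨h0, h1, h2⟩
      apply hf
      rw [hd, h0, h1, h2]
      simp
    · have : B (h f) (e 0) = 0 := by simp [hhf]
      rw [hd] at this
      simp only [map_add, map_smul, LinearMap.add_apply, LinearMap.smul_apply, smul_eq_mul,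
        f₀, f₁₀, f₂₀] at this
      linear_combination this
    · have : B (h f) (e 1) = 0 := by simp [hhf]
      rw [hd] at this
      simp only [map_add, map_smul, LinearMap.add_apply, LinearMap.smul_apply, smul_eq_mul,
        e₀₁, f₁, f₂₁] at this
      linear_combination this
    · have : B (h f) (e 2) = 0 := by simp [hhf]
      rw [hd] at this
      simp only [map_add, map_smul, LinearMap.add_apply, LinearMap.smul_apply, smul_eq_mul,
        e₀₂, e₁₂, f₂] at this
      linear_combination this

end Topological

end IsAdaptedBasis

theorem locus_eq_of_form_eq {V : Type*} [AddCommGroup V] [Module ℂ V]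
    {B : V →ₗ[ℂ] V →ₗ⋆[ℂ] ℂ} {h h' : V →ₗ[ℂ] V} {r : ℝ} (hr : r ≠ 0)
    (heq : ∀ v, B (h' v) v = r * B (h v) v) : locus B h' = locus B h := by
  ext p
  change B (h' p.rep) p.rep = 0 ↔ B (h p.rep) p.rep = 0
  rw [heq]
  simp [hr]

end Giraud

/-! ### Giraud rigidity -/

theorem corollary4p8 {V : Type*} [AddCommGroup V] [Module ℂ V] [TopologicalSpace V]
    [IsTopologicalAddGroup V] [ContinuousSMul ℂ V] [T2Space V]
    (B : V →ₗ[ℂ] V →ₗ⋆[ℂ] ℂ) (hB : Giraud.IsHermitianFormPPM B)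
    (h₁ h₂ : V →ₗ[ℂ] V)
    (hh₁ : Giraud.GivesBisector B h₁) (hh₂ : Giraud.GivesBisector B h₂)
    (hslice : ¬ ∃ S : Set (ℙ ℂ V), Giraud.IsSlice B h₁ S ∧ Giraud.IsSlice B h₂ S)
    (D : Set (ℙ ℂ V))
    (hD : D = Giraud.locus B h₁ ∩ Giraud.locus B h₂ ∩ Giraud.ball B)
    (hDne : D.Nonempty) :
    (∃ f ∈ Giraud.focusSet h₁ ∪ Giraud.focusSet h₂,
      (D \ {f}).Nonempty ∧ Giraud.IsSmoothSurface (D \ {f})) ∧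
    ∀ U : Set (ℙ ℂ V), U.Nonempty → (∃ O : Set (ℙ ℂ V), IsOpen O ∧ U = D ∩ O) →
      {X : Set (ℙ ℂ V) | Giraud.IsBisector B X ∧ X ≠ Giraud.locus B h₁ ∧
        X ≠ Giraud.locus B h₂ ∧ U ⊆ X}.Subsingleton ∧
      ∀ X : Set (ℙ ℂ V), Giraud.IsBisector B X → U ⊆ X →
        Giraud.locus B h₁ ∩ Giraud.locus B h₂ ⊆ X := by
  open Giraud in
  subst hD
  obtain ⟨e, a, l, c, d, k, g, H⟩ :=
    exists_isAdaptedBasis_of_nonempty hB hh₁ hh₂ hslice hDne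
  have hball := isOpen_ball hB
  have hne : ∀ (i : Fin 3), i ≠ 2 → ∀ z,
      affineChart e z ≠ Projectivization.mk ℂ (e i) (e.ne_zero i) := by
    intro i hi z hz
    rw [affineChart, Projectivization.mk_eq_mk_iff'] at hz
    obtain ⟨r, hr⟩ := hz
    have := congrArg (fun v => e.repr v 2) hr
    simp [hi] at this
  have hfocus : ∃ i : Fin 3, i ≠ 2 ∧
      Projectivization.mk ℂ (e i) (e.ne_zero i) ∈ focusSet h₁ ∪ focusSet h₂ ∧
      (locus B h₁ ∩ locus B h₂ ∩ ball B) \ {Projectivization.mk ℂ (e i) (e.ne_zero i)} ⊆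
        Set.range (affineChart e) := by
    have aux : ∀ i : Fin 3, (∀ v, B (h₁ v) v = 0 → B (h₂ v) v = 0 → e.repr v 2 = 0 → v ≠ 0 →
        ∃ r : ℂ, v = r • e i) → (locus B h₁ ∩ locus B h₂ ∩ ball B) \
          {Projectivization.mk ℂ (e i) (e.ne_zero i)} ⊆ Set.range (affineChart e) := by
      rintro i hi p ⟨⟨⟨hp₁, hp₂⟩, -⟩, hp⟩
      induction p using Projectivization.ind with
      | h v hv =>
        by_cases hz : e.repr v 2 = 0
        · exfalso
          apply hp
          obtain ⟨r, hr⟩ := hi v ((mk_mem_locus hv).1 hp₁) ((mk_mem_locus hv).1 hp₂) hz hv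
          rw [Set.mem_singleton_iff, Projectivization.mk_eq_mk_iff']
          exact ⟨r, hr.symm⟩
        · exact ⟨_, affineChart_div e hz hv (basis_decomp e v)⟩
    -- The intersection can meet infinity only at `e 0` if `d = 0`, and only at `e 1` if `a = 0`.
    -- When neither vanishes there is no point to remove, and `e 1` is a harmless choice.
    by_cases hd : d = 0
    · refine ⟨0, by decide, Or.inl ((mk_mem_focusSet _).2 H.ker_left), aux 0 ?_⟩
      intro v hv₁ hv₂ hz hv
      rcases H.eq_smul_of_mem hv₁ hv₂ hz with h | h | h
      · exact absurd hd h.2.1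
      · exact ⟨_, h.2.2⟩
      · exact absurd h hv
    · refine ⟨1, by decide, Or.inr ((mk_mem_focusSet _).2 H.ker_right), aux 1 ?_⟩
      intro v hv₁ hv₂ hz hv
      rcases H.eq_smul_of_mem hv₁ hv₂ hz with h | h | h
      · exact ⟨_, h.2.2⟩
      · exact absurd h.1 hd
      · exact absurd h hv
  constructor
  · obtain ⟨i, hi, hif, hsub⟩ := hfocus
    refine ⟨_, hif, ?_, H.isSmoothSurface hball hsub fun z => ?_⟩
    · obtain ⟨p, ⟨hp₁, hp₂⟩, hp⟩ := hDne
      obtain ⟨z, hz, hz₂, hz₁⟩ := H.exists_affineChart_mem hball hp₁ hp₂ hp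
      exact ⟨affineChart e z, ⟨⟨(H.affineChart_mem_left z).2 hz₁,
        (H.affineChart_mem_right z).2 hz₂⟩, hz⟩, hne i hi z⟩
    · exact ⟨fun h => h.1, fun h => ⟨h, hne i hi z⟩⟩
  · rintro U hU ⟨O, hO, rfl⟩
    rw [Set.inter_assoc] at hU ⊢
    have hO' := hball.inter hO
    refine ⟨?_, ?_⟩
    -- A vanishing coefficient would give back one of the two original bisectors, so for a third one
    -- the determinant condition applies.
    · have coeff : ∀ h : V →ₗ[ℂ] V, GivesBisector B h → locus B h ≠ locus B h₁ →
          locus B h ≠ locus B h₂ → locus B h₁ ∩ locus B h₂ ∩ (ball B ∩ O) ⊆ locus B h →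
          ∃ s t : ℝ, (∀ v, B (h v) v = s * B (h₂ v) v + t * B (h₁ v) v) ∧ s ≠ 0 ∧ t ≠ 0 ∧
            s * (a * (d * g - Complex.normSq k)) + t * (d * (a * c - Complex.normSq l)) = 0 := by
        intro h hg hX₁ hX₂ hX
        obtain ⟨s, t, hst, hor, hrat⟩ := H.exists_combination hB hg hO' hU hX
        have hs : s ≠ 0 := by
          rintro rfl
          exact hX₁ (locus_eq_of_form_eq (r := t) (by simpa using hor) fun v => by
            simp [hst])
        have ht : t ≠ 0 := by
          rintro rfl
          exact hX₂ (locus_eq_of_form_eq (r := s) (by simpa using hor) fun v => by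
            simp [hst])
        exact ⟨s, t, hst, hs, ht, hrat hs ht⟩
      rintro X ⟨⟨h, hg, rfl⟩, hX₁, hX₂, hX⟩ Y ⟨⟨h', hg', rfl⟩, hY₁, hY₂, hY⟩
      obtain ⟨s, t, hst, hs, ht, hr⟩ := coeff h hg hX₁ hX₂ hX
      obtain ⟨s', t', hst', hs', ht', hr'⟩ := coeff h' hg' hY₁ hY₂ hY
      refine locus_eq_of_form_eq (r := t / t') (div_ne_zero ht ht') fun v => ?_
      have hu := H.ratio_unique hr hr'
      have ht'' : (t' : ℂ) ≠ 0 := by exact_mod_cast ht'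
      have hu' : (s : ℂ) * t' = s' * t := by exact_mod_cast hu
      rw [hst, hst']
      push_cast
      field_simp
      linear_combination B (h₂ v) v * hu'
    · rintro X ⟨h, hg, rfl⟩ hX p ⟨hp₁, hp₂⟩
      obtain ⟨s, t, hst, -⟩ := H.exists_combination hB hg hO' hU hX
      change B (h₁ p.rep) p.rep = 0 at hp₁
      change B (h₂ p.rep) p.rep = 0 at hp₂
      change B (h p.rep) p.rep = 0
      rw [hst, hp₁, hp₂]
      simp
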